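/- Let $n\ge 1$. For $\sigma\in S_n$ put $\Phi(\sigma)=\{(i,j)\mid 1\le i<j\le n,\ \sigma(i)>\sigma(j)\}$, and let $\Delta_n^+=\{(i,j)\mid 1\le i<j\le n\}$; identify $(i,j)\in\Delta_n^+$ with the vector $\varepsilon_i-\varepsilon_j$, and let $S_n$ act by $w\varepsilon_i=\varepsilon_{w(i)}$. Let $\mathcal C\subset(\mathbb R^{n-1})^3$ be the (symmetrized) Littlewood–Richardson cone: the set of all $(a,b,c)$ with $a_k=\lambda_k-\lambda_{k+1}$, $b_k=\mu_k-\mu_{k+1}$, $c_k=\nu_k-\nu_{k+1}$ $(1\le k\le n-1)$, where $\lambda,\mu,\nu\in\mathbb R^n$ are the weakly decreasing eigenvalue sequences of Hermitian $n\times n$ matrices $A,B,C$ with $A+B+C=0$. Let $(\mathbb R^{n-1})^3_+$ be the cone $a_k,b_k,c_k\ge 0$. For $w_1,w_2,w_3\in S_n$ let $T_{w_1,w_2,w_3}\subset(\mathbb R^{n-1})^3$ be the image, under the same difference map, of the space of all $(\lambda,\mu,\nu)\in(\mathbb R^n)^3$ with $w_1^{-1}\lambda+w_2^{-1}\mu+w_3^{-1}\nu=0$,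 and put $\mathcal C_{w_1,w_2,w_3}=T_{w_1,w_2,w_3}\cap\mathcal C$. For $\alpha\in\Delta_n^+$, a variable among $a_k,b_k,c_k$ is called the $\alpha$-pivot variable if it is the $k$-th variable of the $s$-th group ($s=1,2,3$ for $a,b,c$) and $-w_s(\alpha)=\varepsilon_k-\varepsilon_{k+1}$. The $\alpha$-free variables are the $k$-th variables of the $t$-th group for those $t$ and $k$ with $w_t(\alpha)=\varepsilon_p-\varepsilon_q$, $p\le k<q$. Let $S_{w_1,w_2,w_3}$ be the set of $\alpha\in\Delta_n^+$ for which one of $-w_1(\alpha),-w_2(\alpha),-w_3(\alpha)$ is a simple root $\varepsilon_k-\varepsilon_{k+1}$. A variable is called a pivot variable if it is an $\alpha$-pivot variable for some $\alpha\in S_{w_1,w_2,w_3}$, and free otherwise. **Corollary.** Assume $\Delta_n^+=\Phi(w_1)\sqcup\Phi(w_2)\sqcup\Phi(w_3)$. Then $\mathcal C_{w_1,w_2,w_3}=T_{w_1,w_2,w_3}\cap(\mathbb R^{n-1})^3_+$, this set meets the interior of $(\mathbb R^{n-1})^3_+$, its linear span has dimension $2(n-1)$ (codimension $n-1$), and $\mathcal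 C_{w_1,w_2,w_3}$ is a simplicial cone, i.e. the conic hull of a finite linearly independent set. Moreover, there are exactly $2(n-1)$ free variables, and $S_{w_1,w_2,w_3}$ can be listed without repetition as $\alpha_1,\alpha_2,\dots$ such that for $i<j$ the $\alpha_i$-pivot variable is not $\alpha_j$-free. For every such list, perform back-substitution in the pivot equations "$\alpha$-pivot variable $=$ sum of the $\alpha$-free variables": start with every variable expressed by itself and, going from the last root of the list to the first, replace the expression of the $\alpha$-pivot variable by the sum of the current expressions of the $\alpha$-free variables. In the end every variable is expressed as a linear form with non-negative integer coefficients in the free variables only, and these expressions are a system of equations for $T_{w_1,w_2,w_3}$. For a free variable $f$ let $r_f$ be the vector whose coordinate at each variable $v$ is the coefficient of $f$ in the expression of $v$. The vectors $r_f$, $f$ free, are linearly independent, and $\mathcal C_{w_1,w_2,w_3}$ is their conic hull. -/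

import Mathlib

namespace LRCone

/-! Throughout `m` is the rank, so that `n = m + 1`: permutations belong to `S_n`, spectra are
vectors in `ℝ^n`, and there are `m = n - 1` gaps between consecutive entries of a spectrum. -/

/-- The pair `(i, j)` stands for the vector `ε_i - ε_j`. -/
abbrev Root (m : ℕ) := Fin (m + 1) × Fin (m + 1)

/-- `Δ_n^+ = {(i, j) | i < j}`. -/
def positiveRoots (m : ℕ) : Set (Root m) := {α | α.1 < α.2}

/-- The inversion set `Φ(σ) = {(i, j) | i < j, σ(i) > σ(j)}`. -/
def inversionSet {m : ℕ} (σ : Equiv.Perm (Fin (m + 1))) : Set (Root m) :=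
  {α | α.1 < α.2 ∧ σ α.2 < σ α.1}

/-- `Δ_n^+ = Φ(w₁) ⊔ Φ(w₂) ⊔ Φ(w₃)`, a disjoint union. -/
def IsInversionDecomposition {m : ℕ} (w : Fin 3 → Equiv.Perm (Fin (m + 1))) : Prop :=
  (⋃ s, inversionSet (w s)) = positiveRoots m ∧
    ∀ s t, s ≠ t → Disjoint (inversionSet (w s)) (inversionSet (w t))

/-- The `3(n-1)` variables `a_k = (0, k)`, `b_k = (1, k)`, `c_k = (2, k)`. -/
abbrev Var (m : ℕ) := Fin 3 × Fin m

/-- The map sending a triple of vectors in `ℝ^n` to its consecutive differences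
`a_k = λ_k - λ_{k+1}`, `b_k = μ_k - μ_{k+1}`, `c_k = ν_k - ν_{k+1}`. Restricted to the hyperplane
`V` of triples with total sum zero it is onto, and its kernel there is the plane `W` of triples of
constant vectors with total sum zero: it is the coordinate form of the projection `V → V / W`. -/
def gaps (m : ℕ) : (Fin 3 → Fin (m + 1) → ℝ) →ₗ[ℝ] (Var m → ℝ) where
  toFun x v := x v.1 v.2.castSucc - x v.1 v.2.succ
  map_add' x y := by
    funext v
    simp only [Pi.add_apply]
    ring
  map_smul' c x := by
    funext v
    simp only [Pi.smul_apply, smul_eq_mul, RingHom.id_apply]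
    ring

/-- `A` is Hermitian and its eigenvalues, with multiplicity and in weakly decreasing order, are
the entries of `x`. -/
def HasOrderedSpectrum {m : ℕ} (A : Matrix (Fin (m + 1)) (Fin (m + 1)) ℂ)
    (x : Fin (m + 1) → ℝ) : Prop :=
  A.IsHermitian ∧ Antitone x ∧
    A.charpoly = ∏ i, (Polynomial.X - Polynomial.C ((x i : ℝ) : ℂ))

/-- The ordered spectra of the triples of Hermitian `n × n` matrices with sum zero. -/
def hermitianSpectra (m : ℕ) : Set (Fin 3 → Fin (m + 1) → ℝ) :=
  {x | ∃ A : Fin 3 → Matrix (Fin (m + 1)) (Fin (m + 1)) ℂ,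
    (∑ s, A s = 0) ∧ ∀ s, HasOrderedSpectrum (A s) (x s)}

/-- The (symmetrized) Littlewood-Richardson cone `𝒞` in `V / W ≅ (ℝ^{n-1})³`. -/
def lrCone (m : ℕ) : Set (Var m → ℝ) := gaps m '' hermitianSpectra m

/-- The dominant cone: all `a_k, b_k, c_k ≥ 0`. -/
def dominantCone (m : ℕ) : Set (Var m → ℝ) := {x | ∀ v, 0 ≤ x v}

/-- The triples with `w₁⁻¹ λ + w₂⁻¹ μ + w₃⁻¹ ν = 0` in `(ℝ^n)³`. As `w ε_i = ε_{w(i)}`, the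
`i`-th entry of `w⁻¹ λ` is the entry of `λ` at `w(i)`. -/
def balancedTriples {m : ℕ} (w : Fin 3 → Equiv.Perm (Fin (m + 1))) :
    Submodule ℝ (Fin 3 → Fin (m + 1) → ℝ) where
  carrier := {x | ∀ i, ∑ s, x s (w s i) = 0}
  add_mem' := by
    intro x y hx hy i
    simp only [Pi.add_apply, Finset.sum_add_distrib]
    rw [hx i, hy i, add_zero]
  zero_mem' := by
    intro i
    simp
  smul_mem' := by
    intro c x hx i
    simp only [Pi.smul_apply, smul_eq_mul, ← Finset.mul_sum]
    rw [hx i, mul_zero]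

/-- The subspace `T_{w₁,w₂,w₃}` of `V / W`. -/
def balancedSubspace {m : ℕ} (w : Fin 3 → Equiv.Perm (Fin (m + 1))) :
    Submodule ℝ (Var m → ℝ) :=
  (balancedTriples w).map (gaps m)

/-- `𝒞_{w₁,w₂,w₃} = T_{w₁,w₂,w₃} ∩ 𝒞`. -/
def lrFace {m : ℕ} (w : Fin 3 → Equiv.Perm (Fin (m + 1))) : Set (Var m → ℝ) :=
  (balancedSubspace w : Set (Var m → ℝ)) ∩ lrCone m

/-- The set `S_{w₁,w₂,w₃}` of the positive roots `α` such that one of `-w₁(α)`, `-w₂(α)`,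
`-w₃(α)` is a simple root `ε_k - ε_{k+1}`. -/
def pivotRoots {m : ℕ} (w : Fin 3 → Equiv.Perm (Fin (m + 1))) : Set (Root m) :=
  {α | α ∈ positiveRoots m ∧ ∃ s, (w s α.1 : ℕ) = (w s α.2 : ℕ) + 1}

/-- `v = (s, k)` is an `α`-pivot variable: `α` is positive and `-w_s(α) = ε_k - ε_{k+1}`. -/
def IsPivotVar {m : ℕ} (w : Fin 3 → Equiv.Perm (Fin (m + 1))) (α : Root m) (v : Var m) : Prop :=
  α.1 < α.2 ∧ w v.1 α.1 = v.2.succ ∧ w v.1 α.2 = v.2.castSucc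

/-- `v = (t, k)` is an `α`-free variable: `w_t(α) = ε_p - ε_q` is positive and `p ≤ k < q`. -/
def IsFreeVar {m : ℕ} (w : Fin 3 → Equiv.Perm (Fin (m + 1))) (α : Root m) (v : Var m) : Prop :=
  w v.1 α.1 ≤ v.2.castSucc ∧ v.2.succ ≤ w v.1 α.2

instance {m : ℕ} (w : Fin 3 → Equiv.Perm (Fin (m + 1))) (α : Root m) (v : Var m) :
    Decidable (IsPivotVar w α v) := by
  unfold IsPivotVar
  infer_instance

instance {m : ℕ} (w : Fin 3 → Equiv.Perm (Fin (m + 1))) (α : Root m) (v : Var m) :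
    Decidable (IsFreeVar w α v) := by
  unfold IsFreeVar
  infer_instance

/-- The free variables: those that are not an `α`-pivot variable for any `α`. -/
def freeVars {m : ℕ} (w : Fin 3 → Equiv.Perm (Fin (m + 1))) : Finset (Var m) :=
  {v | ∀ α : Root m, ¬ IsPivotVar w α v}

/-- The list `l = [α₁, α₂, …]` runs through `S_{w₁,w₂,w₃}` without repetition, and for `i < j`
the `α_i`-pivot variable is not `α_j`-free. -/
def IsTriangularOrder {m : ℕ} (w : Fin 3 → Equiv.Perm (Fin (m + 1))) (l : List (Root m)) : Prop :=
  l.Nodup ∧ (∀ α, α ∈ l ↔ α ∈ pivotRoots w) ∧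
    l.Pairwise fun α β => ∀ v, IsPivotVar w α v → ¬ IsFreeVar w β v

/-- Back-substitution in the pivot equations
`(α-pivot variable) = ∑ (α-free variables)`, taken from the last root of the list to the first.
The linear form `∑_u (E v u) u` is the current expression of the variable `v`: at the start every
variable is expressed by itself, and treating `α` replaces the expression of the `α`-pivot variable
by the sum of the current expressions of the `α`-free variables. -/
def backSubst {m : ℕ} (w : Fin 3 → Equiv.Perm (Fin (m + 1))) :
    List (Root m) → Var m → Var m → ℕ
  | [] => fun v => Pi.single v 1
  | α :: l => fun v =>
      if IsPivotVar w α v then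
        ∑ u with IsFreeVar w α u, backSubst w l u
      else backSubst w l v

/-- The vector attached to the variable `f`: its `v`-th coordinate is the coefficient of `f` in the
expression of `v` that back-substitution yields. -/
def ray {m : ℕ} (w : Fin 3 → Equiv.Perm (Fin (m + 1))) (l : List (Root m)) (f : Var m) :
    Var m → ℝ :=
  fun v => (backSubst w l v f : ℝ)

end LRCone

/-! A dominant point of `T` lies in the Littlewood-Richardson cone because diagonal matrices realise
it: put the spectra on the diagonals in the orders given by `w`, and balance makes the sum zero.
What remains is linear algebra on `T`. Let α be inverted by `w s` at adjacent positions. The other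
two maps keep the order of α, so subtracting the balance equations at its two ends writes one gap of
group `s` as a sum of gaps of the other groups (`pivot_equation`). A pivot variable of α can be
β-free only if β is strictly higher (`height_lt`), so decreasing height is a triangular order, and
back-substitution places `T` in a space parametrised by the free variables. Equality is a dimension
squeeze: 2(n-1) ≤ dim `T` ≤ number of free variables ≤ 2(n-1). The last bound, the combinatorial
core, says that there are at least n-1 adjacent inversions (`card_le_adjacentInversions`). Since all
coefficients are non-negative and the rays are dual to the free coordinates, the dominant part of
`T` is the cone on the rays. -/

namespace LRCone

/-! ### Counting adjacent inversions. -/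

section AdjacentInversions

variable {ι α β : Type*} [LinearOrder α] [LinearOrder β]

/-- The pairs of `A` that are inverted by some `w s` and have adjacent positions in `w s '' A`. -/
def IsAdjacentInversion (w : ι → α → β) (A : Finset α) (p : α × α) : Prop :=
  p.1 ∈ A ∧ p.2 ∈ A ∧ p.1 < p.2 ∧
    ∃ s, w s p.2 < w s p.1 ∧ ∀ z ∈ A, ¬ (w s p.2 < w s z ∧ w s z < w s p.1)

/-- Every increasing pair is inverted by exactly one of the maps `w s`. -/
structure InvertsOnce (w : ι → α → β) : Prop where
  injective : ∀ s, Function.Injective (w s)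
  exists_inverts : ∀ i j, i < j → ∃ s, w s j < w s i
  unique : ∀ i j s t, i < j → w s j < w s i → w t j < w t i → s = t

/-- If a new greatest element `n` is added to `A`, then for some `s` the element of `A` placed
right above `n` by `w s` does not form an inversion with the one placed right below `n`. -/
theorem InvertsOnce.exists_unbroken {w : ι → α → β} (hw : InvertsOnce w) {A : Finset α}
    (hA : A.Nonempty) {n : α} (hn : ∀ x ∈ A, x < n) :
    ∃ y ∈ A, ∃ s, w s n < w s y ∧ (∀ z ∈ A, w s n < w s z → w s y ≤ w s z) ∧
      ∀ j ∈ A, y < j → w s j < w s n → ∃ z ∈ A, w s j < w s z ∧ w s z < w s n := by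
  classical
  by_contra! hcon
  have habove : ∀ s, ∀ x ∈ A, w s n < w s x → ∃ y ∈ A, w s n < w s y ∧
      (∀ z ∈ A, w s n < w s z → w s y ≤ w s z) := by
    intro s x hx hxn
    obtain ⟨y, hy, hmin⟩ := Finset.exists_min_image (A.filter fun z => w s n < w s z) (w s)
      ⟨x, by simp [hx, hxn]⟩
    simp only [Finset.mem_filter] at hy hmin
    exact ⟨y, hy.1, hy.2, fun z hz hz' => hmin z ⟨hz, hz'⟩⟩
  -- Under the negated claim, whenever `n` is not on top of `w s`, its upper neighbour `y` and lower
  -- neighbour `j` exist and form an inversion `y < j`.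
  have hpair : ∀ s, ∀ x ∈ A, w s n < w s x → ∃ y ∈ A, w s n < w s y ∧
      (∀ z ∈ A, w s n < w s z → w s y ≤ w s z) ∧ ∃ j ∈ A, y < j ∧ w s j < w s n ∧
      ∀ z ∈ A, w s z < w s n → w s z ≤ w s j := by
    intro s x hx hxn
    obtain ⟨y, hy, hyn, hmin⟩ := habove s x hx hxn
    obtain ⟨j, hj, hyj, hjn, hmax⟩ := hcon y hy s hyn hmin
    refine ⟨y, hy, hyn, hmin, j, hj, hyj, hjn, fun z hz hzn => ?_⟩
    by_contra! hlt
    exact absurd hzn (not_lt.2 (hmax z hz hlt))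
  have hne : ∀ s, ∀ x ∈ A, ¬ w s n < w s x → w s x < w s n := fun s x hx h =>
    lt_of_le_of_ne (not_lt.1 h) fun h' => (hn x hx).ne (hw.injective s h')
  have hMA := A.max'_mem hA
  have hMle : ∀ x ∈ A, x ≤ A.max' hA := fun x hx => A.le_max' x hx
  set M := A.max' hA
  obtain ⟨s, hs⟩ := hw.exists_inverts M n (hn M hMA)
  obtain ⟨ys, hys, hysn, hysmin, xs, hxs, hyxs, hxsn, hxsmax⟩ := hpair s M hMA hs
  obtain ⟨t, ht⟩ := hw.exists_inverts xs n (hn xs hxs)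
  obtain ⟨yt, hyt, hytn, hytmin, xt, hxt, hyxt, hxtn, hxtmax⟩ := hpair t xs hxs ht
  have hst : s ≠ t := by rintro rfl; exact lt_asymm hxsn ht
  have hMt : w t M < w t n := hne t M hMA fun h => hst (hw.unique M n s t (hn M hMA) hs h)
  -- Otherwise a third map `u` inverts `(xt, n)`, hence also `(xt, M)`. So `t` does not invert `(xt,
  -- M)`, and `M` lies between `xt` and `n` in `w t`, against the choice of `xt`.
  have hxts : w s n < w s xt := by
    by_contra hns
    have hns := hne s xt hxt hns
    obtain ⟨u, hu⟩ := hw.exists_inverts xt n (hn xt hxt)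
    have hus : u ≠ s := by rintro rfl; exact lt_asymm hns hu
    have hut : u ≠ t := by rintro rfl; exact lt_asymm hxtn hu
    have hxM : xt < M :=
      lt_of_le_of_ne (hMle xt hxt) fun h => lt_asymm hns (h ▸ hs)
    have hMu : w u M < w u n := hne u M hMA fun h => hus (hw.unique M n u s (hn M hMA) h hs)
    have hlt : w t xt < w t M := by
      rcases lt_trichotomy (w t M) (w t xt) with h | h | h
      · exact absurd (hw.unique xt M u t hxM (hMu.trans hu) h) hut
      · exact absurd (hw.injective t h) hxM.ne'
      · exact h
    exact absurd (hxtmax M hMA hMt) (not_le.2 hlt)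
  have hysxt : w s ys ≤ w s xt := hysmin xt hxt hxts
  have hyst : w t ys < w t n := hne t ys hys fun h => hst (hw.unique ys n s t (hn ys hys) hysn h)
  have hytxs : w t yt ≤ w t xs := hytmin xs hxs ht
  have hyts : w s yt < w s n := hne s yt hyt fun h => hst (hw.unique yt n s t (hn yt hyt) h hytn)
  have hysxt' : w t ys ≤ w t xt := hxtmax ys hys hyst
  have hytxs' : w s yt ≤ w s xs := hxsmax yt hyt hyts
  -- If `ys < yt < xt`, the map inverting `(ys, xt)` is neither `s` nor `t`, yet it must invert
  -- `(ys, yt)` or `(yt, xt)`, which belong to `s` and `t`. The case `yt < ys < xs` is symmetric.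
  rcases lt_trichotomy ys yt with h | h | h
  · have hlt : ys < xt := h.trans hyxt
    obtain ⟨u, hu⟩ := hw.exists_inverts ys xt hlt
    have hus : u ≠ s := by rintro rfl; exact absurd hysxt (not_le.2 hu)
    have hut : u ≠ t := by rintro rfl; exact absurd hysxt' (not_le.2 hu)
    rcases lt_or_ge (w u yt) (w u ys) with h' | h'
    · exact hus (hw.unique ys yt u s h h' (hyts.trans hysn))
    · exact hut (hw.unique yt xt u t hyxt (hu.trans_le h') (hxtn.trans hytn))
  · rw [h] at hysn
    exact lt_asymm hysn hyts
  · have hlt : yt < xs := h.trans hyxs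
    obtain ⟨u, hu⟩ := hw.exists_inverts yt xs hlt
    have hus : u ≠ s := by rintro rfl; exact absurd hytxs' (not_le.2 hu)
    have hut : u ≠ t := by rintro rfl; exact absurd hytxs (not_le.2 hu)
    rcases lt_or_ge (w u ys) (w u yt) with h' | h'
    · exact hut (hw.unique yt ys u t h h' (hyst.trans hytn))
    · exact hus (hw.unique ys xs u s hyxs (hu.trans_le h') (hxsn.trans hysn))

/-- There are at least `#A - 1` adjacent inversions in `A`. -/
theorem InvertsOnce.card_le_adjacentInversions {w : ι → α → β} (hw : InvertsOnce w)
    (A : Finset α) : ∃ P : Finset (α × α), (∀ p ∈ P, IsAdjacentInversion w A p) ∧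
      A.card ≤ P.card + 1 := by
  classical
  suffices h : A.card ≤ ((A ×ˢ A).filter (IsAdjacentInversion w A)).card + 1 from
    ⟨_, fun p hp => (Finset.mem_filter.1 hp).2, h⟩
  induction A using Finset.induction_on_max with
  | empty => simp
  | insert n A hn ih =>
    rcases A.eq_empty_or_nonempty with rfl | hA
    · simp
    have hnA : n ∉ A := fun h => lt_irrefl n (hn n h)
    rw [Finset.card_insert_of_notMem hnA]
    obtain ⟨y, hy, s, hyn, hymin, hybelow⟩ := hw.exists_unbroken hA hn
    set P := (A ×ˢ A).filter (IsAdjacentInversion w A)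
    set Q := (insert n A ×ˢ insert n A).filter (IsAdjacentInversion w (insert n A))
    have hP : ∀ p, p ∈ P ↔ IsAdjacentInversion w A p := fun p => by
      simp only [P, Finset.mem_filter, Finset.mem_product, and_iff_right_iff_imp]
      exact fun h => ⟨h.1, h.2.1⟩
    have hQ : ∀ p, p ∈ Q ↔ IsAdjacentInversion w (insert n A) p := fun p => by
      simp only [Q, Finset.mem_filter, Finset.mem_product, and_iff_right_iff_imp]
      exact fun h => ⟨h.1, h.2.1⟩
    have hbroken : ∀ p ∈ P, p ∉ Q → ∃ r, w r p.2 < w r n ∧ w r n < w r p.1 ∧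
        ∀ z ∈ A, ¬ (w r p.2 < w r z ∧ w r z < w r p.1) := by
      intro p hp hpQ
      obtain ⟨h1, h2, h3, r, h4, h5⟩ := (hP p).1 hp
      by_contra! hcon
      refine hpQ ((hQ p).2 ⟨Finset.mem_insert_of_mem h1, Finset.mem_insert_of_mem h2, h3, r, h4,
        fun z hz hzz => ?_⟩)
      rcases Finset.mem_insert.1 hz with rfl | hz
      · obtain ⟨z', hz', hz''⟩ := hcon r hzz.1 hzz.2
        exact h5 z' hz' hz''
      · exact h5 z hz hzz
    -- An adjacent inversion split by `n` is replaced by its larger-valued end paired with `n`. This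
    -- is injective and misses `(y, n)`, so each new element adds at least one adjacent inversion.
    let g : α × α → α × α := fun p => if p ∈ Q then p else (p.1, n)
    have hgQ : ∀ p ∈ P, g p ∈ Q.erase (y, n) := by
      intro p hp
      obtain ⟨h1, h2, h3, -⟩ := (hP p).1 hp
      by_cases hpQ : p ∈ Q
      · simp only [g, if_pos hpQ, Finset.mem_erase]
        refine ⟨?_, hpQ⟩
        rintro rfl
        exact hnA h2
      · obtain ⟨r, h4, h5, h6⟩ := hbroken p hp hpQ
        simp only [g, if_neg hpQ, Finset.mem_erase]
        constructor
        · intro h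
          have hpy : p.1 = y := congrArg Prod.fst h
          rw [hpy] at h5 h3 h6
          obtain rfl := hw.unique y n r s (hn y hy) h5 hyn
          obtain ⟨z, hz, hz1, hz2⟩ := hybelow p.2 h2 h3 h4
          exact h6 z hz ⟨hz1, hz2.trans hyn⟩
        · refine (hQ _).2 ⟨Finset.mem_insert_of_mem h1, Finset.mem_insert_self _ _, hn _ h1, r, h5,
            fun z hz hzz => ?_⟩
          rcases Finset.mem_insert.1 hz with rfl | hz
          · exact lt_irrefl _ hzz.1
          · exact h6 z hz ⟨h4.trans hzz.1, hzz.2⟩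
    have hginj : Set.InjOn g P := by
      intro p hp q hq hpq
      have hp' := (hP p).1 hp
      have hq' := (hP q).1 hq
      by_cases hpQ : p ∈ Q <;> by_cases hqQ : q ∈ Q
      · simpa only [g, if_pos hpQ, if_pos hqQ] using hpq
      · simp only [g, if_pos hpQ, if_neg hqQ] at hpq
        have h : p.2 = n := congrArg Prod.snd hpq
        exact absurd (h ▸ hp'.2.1) hnA
      · simp only [g, if_neg hpQ, if_pos hqQ] at hpq
        have h : q.2 = n := (congrArg Prod.snd hpq).symm
        exact absurd (h ▸ hq'.2.1) hnA
      · simp only [g, if_neg hpQ, if_neg hqQ] at hpq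
        have h1 : p.1 = q.1 := (Prod.mk.inj hpq).1
        obtain ⟨r, h4, h5, h6⟩ := hbroken p hp hpQ
        obtain ⟨r', h4', h5', h6'⟩ := hbroken q hq hqQ
        rw [← h1] at h5' h6'
        obtain rfl := hw.unique p.1 n r r' (hn _ hp'.1) h5 h5'
        refine Prod.ext h1 (hw.injective r ?_)
        rcases lt_trichotomy (w r p.2) (w r q.2) with h | h | h
        · exact absurd ⟨h, h4'.trans h5⟩ (h6 _ hq'.2.1)
        · exact h
        · exact absurd ⟨h, h4.trans h5⟩ (h6' _ hp'.2.1)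
    have hyQ : (y, n) ∈ Q := by
      refine (hQ _).2 ⟨Finset.mem_insert_of_mem hy, Finset.mem_insert_self _ _, hn y hy, s, hyn,
        fun z hz hzz => ?_⟩
      rcases Finset.mem_insert.1 hz with rfl | hz
      · exact lt_irrefl _ hzz.1
      · exact absurd hzz.2 (not_lt.2 (hymin z hz hzz.1))
    have hcard := Finset.card_le_card_of_injOn g hgQ hginj
    rw [Finset.card_erase_of_mem hyQ] at hcard
    have := Finset.card_pos.2 ⟨_, hyQ⟩
    omega

end AdjacentInversions

/-! ### Pivot and free variables. -/

variable {m : ℕ} {w : Fin 3 → Equiv.Perm (Fin (m + 1))}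

theorem IsInversionDecomposition.invertsOnce (hw : IsInversionDecomposition w) :
    InvertsOnce fun s i => w s i where
  injective s := (w s).injective
  exists_inverts i j hij := by
    have h : (i, j) ∈ ⋃ s, inversionSet (w s) := hw.1 ▸ hij
    obtain ⟨s, hs⟩ := Set.mem_iUnion.1 h
    exact ⟨s, hs.2⟩
  unique i j s t hij hs ht := by
    by_contra hst
    exact Set.disjoint_left.1 (hw.2 s t hst) (show (i, j) ∈ inversionSet (w s) from ⟨hij, hs⟩)
      ⟨hij, ht⟩

theorem IsPivotVar.root_unique {α β : Root m} {v : Var m} (hα : IsPivotVar w α v)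
    (hβ : IsPivotVar w β v) : α = β :=
  Prod.ext ((w v.1).injective (hα.2.1.trans hβ.2.1.symm))
    ((w v.1).injective (hα.2.2.trans hβ.2.2.symm))

theorem IsPivotVar.mem_pivotRoots {α : Root m} {v : Var m} (h : IsPivotVar w α v) :
    α ∈ pivotRoots w :=
  ⟨h.1, v.1, by rw [h.2.1, h.2.2]; simp⟩

theorem IsPivotVar.inverts {α : Root m} {v : Var m} (h : IsPivotVar w α v) :
    w v.1 α.2 < w v.1 α.1 := by
  rw [h.2.1, h.2.2]
  exact Fin.castSucc_lt_succ

theorem exists_isPivotVar {α : Root m} (hα : α ∈ pivotRoots w) : ∃ v, IsPivotVar w α v := by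
  obtain ⟨h, s, hs⟩ := hα
  have hlt : (w s α.2 : ℕ) < m := by have := (w s α.1).isLt; omega
  exact ⟨(s, ⟨w s α.2, hlt⟩), h, Fin.ext hs, Fin.ext rfl⟩

theorem IsPivotVar.not_isFreeVar {α : Root m} {v : Var m} (h : IsPivotVar w α v) :
    ¬ IsFreeVar w α v := fun h' => by
  have := h'.1
  rw [h.2.1] at this
  exact absurd this (not_le.2 Fin.castSucc_lt_succ)

/-- The other two maps do not invert α, so each contributes a nonempty interval of gaps. This keeps
the back-substituted expressions nonzero. -/
theorem IsInversionDecomposition.exists_isFreeVar (hw : IsInversionDecomposition w) {α : Root m}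
    {v : Var m} (h : IsPivotVar w α v) : ∃ u, IsFreeVar w α u := by
  obtain ⟨t, ht⟩ := exists_ne v.1
  have hlt : w t α.1 < w t α.2 := by
    rcases lt_trichotomy (w t α.1) (w t α.2) with h' | h' | h'
    · exact h'
    · exact absurd ((w t).injective h') h.1.ne
    · exact absurd (hw.invertsOnce.unique _ _ t v.1 h.1 h' h.inverts) ht
  have hm : (w t α.1 : ℕ) < m := by
    have := (w t α.2).isLt
    have : (w t α.1 : ℕ) < w t α.2 := hlt
    omega
  exact ⟨(t, ⟨w t α.1, hm⟩), le_refl _, Fin.le_def.2 (by simpa using hlt)⟩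

/-- There are at most `2 (n - 1)` free variables. -/
theorem IsInversionDecomposition.card_freeVars_le (hw : IsInversionDecomposition w) :
    (freeVars w).card ≤ 2 * m := by
  classical
  obtain ⟨P, hP, hcard⟩ := hw.invertsOnce.card_le_adjacentInversions Finset.univ
  have hpiv : ∀ α ∈ P, ∃ v, IsPivotVar w α v := by
    intro α hα
    obtain ⟨-, -, h, s, hs, hadj⟩ := hP α hα
    refine exists_isPivotVar ⟨h, s, ?_⟩
    have hs' : (w s α.2 : ℕ) < w s α.1 := hs
    by_contra hne
    have hlt : (w s α.2 : ℕ) + 1 < m + 1 := by have := (w s α.1).isLt; omega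
    refine hadj ((w s).symm ⟨(w s α.2 : ℕ) + 1, hlt⟩) (Finset.mem_univ _) ?_
    simp only [Equiv.apply_symm_apply, Fin.lt_def]
    omega
  have hle : P.card ≤ (freeVars w)ᶜ.card := by
    rcases P.eq_empty_or_nonempty with rfl | ⟨α, hα⟩
    · simp
    have : Nonempty (Var m) := (hpiv α hα).nonempty
    choose! v hv using hpiv
    refine Finset.card_le_card_of_injOn v (fun α hα => ?_) fun α hα β hβ h => ?_
    · simp only [freeVars, Finset.coe_compl, Set.mem_compl_iff, Finset.mem_coe, Finset.mem_filter,
        Finset.mem_univ, true_and]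
      exact fun h => h α (hv α hα)
    · exact (hv α hα).root_unique (h ▸ hv β hβ)
  have hV : Fintype.card (Var m) = 3 * m := by simp
  have hle' := (freeVars w).card_le_univ
  rw [Finset.card_compl, hV] at hle
  rw [hV] at hle'
  rw [Finset.card_univ, Fintype.card_fin] at hcard
  omega

/-! ### Root heights and the triangular order. -/

/-- If the `α`-pivot variable is `β`-free, then `β` is higher than `α`. -/
theorem IsInversionDecomposition.height_lt (hw : IsInversionDecomposition w) {α β : Root m}
    {v : Var m} (hα : IsPivotVar w α v) (hβ : β ∈ pivotRoots w) (hfree : IsFreeVar w β v) :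
    (α.2 : ℕ) + β.1 < β.2 + α.1 := by
  obtain ⟨i, j⟩ := α
  obtain ⟨p, q⟩ := β
  obtain ⟨u, hu⟩ := exists_isPivotVar hβ
  have hw' := hw.invertsOnce
  obtain ⟨s, k⟩ := v
  obtain ⟨t, k'⟩ := u
  have hij : i < j := hα.1
  have hpq : p < q := hu.1
  have hinv : w s j < w s i := hα.inverts
  have hinv' : w t q < w t p := hu.inverts
  have h1 : w s p ≤ w s j := by rw [hα.2.2]; exact hfree.1
  have h2 : w s i ≤ w s q := by rw [hα.2.1]; exact hfree.2
  have hadj : ∀ z, ¬ (w t q < w t z ∧ w t z < w t p) := by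
    intro z hz
    have e1 : w t p = k'.succ := hu.2.1
    have e2 : w t q = k'.castSucc := hu.2.2
    rw [e1, e2] at hz
    simp only [Fin.lt_def, Fin.val_castSucc, Fin.val_succ] at hz
    omega
  have hst : s ≠ t := by
    rintro rfl
    exact absurd (h1.trans (hinv.le.trans h2)) (not_le.2 hinv')
  have hnot : ∀ a b, a < b → w s b < w s a → w t a < w t b := fun a b hab h => by
    rcases lt_trichotomy (w t a) (w t b) with h' | h' | h'
    · exact h'
    · exact absurd ((w t).injective h') hab.ne
    · exact absurd (hw'.unique a b s t hab h h') hst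
  -- the two roots are nested
  have hpi : p ≤ i := by
    -- If `i < p`, then `w s` inverts `(i, p)`, and adjacency forces `w t i < w t q`. The map
    -- inverting `(i, q)` must invert `(i, p)` or `(p, q)`, so it is `w s` or `w t`; neither inverts
    -- `(i, q)`.
    by_contra! hip
    have hip' : w t i < w t p := hnot i p hip (h1.trans_lt hinv)
    have hiq := hip.trans hpq
    rcases lt_trichotomy (w t q) (w t i) with h | h | h
    · exact hadj i ⟨h, hip'⟩
    · exact hiq.ne' ((w t).injective h)
    · obtain ⟨r, hr⟩ := hw'.exists_inverts i q hiq
      rcases lt_or_ge (w r p) (w r i) with h' | h'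
      · obtain rfl := hw'.unique i p r s hip h' (h1.trans_lt hinv)
        exact absurd h2 (not_le.2 hr)
      · obtain rfl := hw'.unique p q r t hpq (lt_of_lt_of_le hr h') hinv'
        exact lt_asymm h hr
  have hjq : j ≤ q := by
    by_contra! hqj
    have hqj' : w t q < w t j := hnot q j hqj (hinv.trans_le h2)
    have hpj := hpq.trans hqj
    rcases lt_trichotomy (w t j) (w t p) with h | h | h
    · exact hadj j ⟨hqj', h⟩
    · exact hpj.ne' ((w t).injective h)
    · obtain ⟨r, hr⟩ := hw'.exists_inverts p j hpj
      rcases lt_or_ge (w r j) (w r q) with h' | h'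
      · obtain rfl := hw'.unique q j r s hqj h' (hinv.trans_le h2)
        exact absurd h1 (not_le.2 hr)
      · obtain rfl := hw'.unique p q r t hpq (lt_of_le_of_lt h' hr) hinv'
        exact lt_asymm h hr
  have hne : p ≠ i ∨ j ≠ q := by
    by_contra! h
    obtain ⟨rfl, rfl⟩ := h
    exact lt_asymm (hnot p j hij hinv) hinv'
  simp only
  have h3 : (p : ℕ) ≤ i := hpi
  have h4 : (j : ℕ) ≤ q := hjq
  simp only [ne_eq, Fin.ext_iff] at hne
  omega

theorem IsInversionDecomposition.exists_isTriangularOrder (hw : IsInversionDecomposition w) :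
    ∃ l : List (Root m), IsTriangularOrder w l := by
  classical
  -- Decreasing height, written with sums to avoid truncated subtraction.
  let le : Root m → Root m → Bool := fun α β =>
    decide ((β.2 : ℕ) + α.1 ≤ (α.2 : ℕ) + β.1)
  let l₀ := (Finset.univ.filter fun α => α ∈ pivotRoots w).toList
  have hperm : (l₀.mergeSort le).Perm l₀ := List.mergeSort_perm l₀ le
  have hmem : ∀ α, α ∈ l₀.mergeSort le ↔ α ∈ pivotRoots w := fun α => by
    rw [hperm.mem_iff]
    simp [l₀]
  refine ⟨l₀.mergeSort le, hperm.nodup_iff.2 (Finset.nodup_toList _), hmem, ?_⟩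
  have hsorted : (l₀.mergeSort le).Pairwise fun α β => le α β = true := by
    apply List.pairwise_mergeSort
    · intro a b c hab hbc
      simp only [le, decide_eq_true_eq] at hab hbc ⊢
      omega
    · intro a b
      simp only [le, Bool.or_eq_true, decide_eq_true_eq]
      omega
  refine hsorted.imp_of_mem fun {α β} _ hβ hle v hα hfree => ?_
  have := hw.height_lt hα ((hmem β).1 hβ) hfree
  simp only [le, decide_eq_true_eq] at hle
  omega

/-! ### Back-substitution -/

theorem backSubst_cons (α : Root m) (l : List (Root m)) (v : Var m) :
    backSubst w (α :: l) v = if IsPivotVar w α v then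
      ∑ u with IsFreeVar w α u, backSubst w l u else backSubst w l v := rfl

/-- A variable that is free for no root of the list is never substituted into another expression. -/
theorem eq_of_backSubst_ne_zero {l : List (Root m)} {v u : Var m}
    (hu : ∀ β ∈ l, ¬ IsFreeVar w β u) (h : backSubst w l v u ≠ 0) : v = u := by
  induction l generalizing v with
  | nil =>
    by_contra hne
    exact h (Pi.single_eq_of_ne (Ne.symm hne) 1)
  | cons β l ih =>
    have ih' := fun {v} => ih (v := v) fun γ hγ => hu γ (List.mem_cons_of_mem _ hγ)
    rw [backSubst_cons] at h
    split_ifs at h with hv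
    · rw [Finset.sum_apply] at h
      obtain ⟨u', hu', hne⟩ := Finset.exists_ne_zero_of_sum_ne_zero h
      rw [ih' hne] at hu'
      exact absurd (Finset.mem_filter.1 hu').2 (hu β List.mem_cons_self)
    · exact ih' h

/-- No pivot variable of a triangular list is left by back-substitution. -/
theorem not_isPivotVar_of_backSubst_ne_zero {l : List (Root m)}
    (hl : l.Pairwise fun α β => ∀ v, IsPivotVar w α v → ¬ IsFreeVar w β v) {v u : Var m}
    (h : backSubst w l v u ≠ 0) : ∀ α ∈ l, ¬ IsPivotVar w α u := by
  induction l generalizing v with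
  | nil => simp
  | cons α l ih =>
    rw [List.pairwise_cons] at hl
    rw [backSubst_cons] at h
    have key : ∀ v', backSubst w l v' u ≠ 0 → IsPivotVar w α u → v' = u := fun v' h' hp =>
      eq_of_backSubst_ne_zero (fun β hβ => hl.1 β hβ u hp) h'
    intro β hβ
    split_ifs at h with hv
    · rw [Finset.sum_apply] at h
      obtain ⟨u', hu', hne⟩ := Finset.exists_ne_zero_of_sum_ne_zero h
      rcases List.mem_cons.1 hβ with rfl | hβ
      · intro hp
        rw [key u' hne hp] at hu'
        exact hp.not_isFreeVar (Finset.mem_filter.1 hu').2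
      · exact ih hl.2 hne β hβ
    · rcases List.mem_cons.1 hβ with rfl | hβ
      · intro hp
        exact hv (key v h hp ▸ hp)
      · exact ih hl.2 h β hβ

theorem IsTriangularOrder.mem_freeVars {l : List (Root m)} (hl : IsTriangularOrder w l)
    {v u : Var m} (h : backSubst w l v u ≠ 0) : u ∈ freeVars w := by
  simp only [freeVars, Finset.mem_filter, Finset.mem_univ, true_and]
  exact fun α hα => not_isPivotVar_of_backSubst_ne_zero hl.2.2 h α
    ((hl.2.1 α).2 hα.mem_pivotRoots) hα

/-- A free variable is expressed by itself. -/
theorem backSubst_of_mem_freeVars (l : List (Root m)) {f : Var m} (hf : f ∈ freeVars w) :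
    backSubst w l f = Pi.single f 1 := by
  simp only [freeVars, Finset.mem_filter, Finset.mem_univ, true_and] at hf
  induction l with
  | nil => rfl
  | cons α l ih => rw [backSubst_cons, if_neg (hf α), ih]

/-- Makes every coordinate of the sum of the rays positive, which gives an interior point of the
dominant cone. -/
theorem backSubst_sum_pos (hw : IsInversionDecomposition w) (l : List (Root m)) (v : Var m) :
    0 < ∑ u, backSubst w l v u := by
  induction l generalizing v with
  | nil => simp [backSubst]
  | cons α l ih =>
    rw [backSubst_cons]
    split_ifs with hv
    · simp only [Finset.sum_apply]
      rw [Finset.sum_comm]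
      obtain ⟨u, hu⟩ := hw.exists_isFreeVar hv
      exact Finset.sum_pos (fun u _ => ih u) ⟨u, by simp [hu]⟩
    · exact ih v

/-- Back-substitution is valid for every solution of the pivot equations. -/
theorem eq_sum_backSubst {x : Var m → ℝ}
    (hx : ∀ α v, IsPivotVar w α v → x v = ∑ u with IsFreeVar w α u, x u) (l : List (Root m))
    (v : Var m) : x v = ∑ u, (backSubst w l v u : ℝ) * x u := by
  induction l generalizing v with
  | nil => simp [backSubst, Pi.single_apply]
  | cons α l ih =>
    rw [backSubst_cons]
    split_ifs with hv
    · simp only [Finset.sum_apply, Nat.cast_sum, Finset.sum_mul]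
      rw [Finset.sum_comm, hx α v hv]
      exact Finset.sum_congr rfl fun u _ => ih u
    · exact ih v

/-- The general `g` covers both the value of the linear form and the bare sum of its coefficients.
-/
theorem IsTriangularOrder.sum_backSubst {l : List (Root m)} (hl : IsTriangularOrder w l)
    (v : Var m) {M : Type*} [AddCommMonoid M] (g : ℕ → Var m → M) (hg : ∀ u, g 0 u = 0) :
    ∑ f ∈ freeVars w, g (backSubst w l v f) f = ∑ u, g (backSubst w l v u) u := by
  refine Finset.sum_subset (Finset.subset_univ _) fun u _ hu => ?_
  rw [not_not.1 fun h => hu (hl.mem_freeVars h), hg]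

/-! ### The pivot equations on the subspace `T` -/

theorem sum_gaps_between (y : Fin (m + 1) → ℝ) (a b : Fin (m + 1)) :
    ∑ k : Fin m with a ≤ k.castSucc ∧ k.succ ≤ b, (y k.castSucc - y k.succ) =
      if a ≤ b then y a - y b else 0 := by
  induction b using Fin.induction with
  | zero =>
    rw [Finset.sum_eq_zero]
    · split_ifs with h
      · rw [le_antisymm h (Fin.zero_le a), sub_self]
      · rfl
    · intro k hk
      exact absurd (Finset.mem_filter.1 hk).2.2 (not_le.2 (Fin.succ_pos k))
  | succ b ih =>
    rcases lt_trichotomy a b.succ with h | h | h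
    · have hab : a ≤ b.castSucc := Fin.le_castSucc_iff.2 h
      have hset : (Finset.univ.filter fun k : Fin m => a ≤ k.castSucc ∧ k.succ ≤ b.succ) =
          insert b (Finset.univ.filter fun k : Fin m =>
            a ≤ k.castSucc ∧ k.succ ≤ b.castSucc) := by
        ext k
        simp only [Finset.mem_filter, Finset.mem_univ, true_and, Finset.mem_insert, Fin.le_def,
          Fin.val_succ, Fin.val_castSucc, Fin.ext_iff] at hab ⊢
        omega
      rw [hset, Finset.sum_insert (by simp), ih, if_pos hab, if_pos h.le]
      ring
    · rw [Finset.sum_eq_zero, if_pos h.le, h, sub_self]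
      intro k hk
      have h1 := (Finset.mem_filter.1 hk).2
      simp only [h, Fin.le_def, Fin.val_succ, Fin.val_castSucc] at h1
      omega
    · rw [Finset.sum_eq_zero, if_neg (not_le.2 h)]
      intro k hk
      have h1 := (Finset.mem_filter.1 hk).2
      simp only [Fin.le_def, Fin.lt_def, Fin.val_succ, Fin.val_castSucc] at h1 h
      omega

/-- In the difference of the two balance equations, the groups that keep the order of α telescope to
their α-free gaps, while the inverting group gives minus the pivot gap. -/
theorem IsInversionDecomposition.pivot_equation (hw : IsInversionDecomposition w)
    {x : Var m → ℝ} (hx : x ∈ balancedSubspace w) {α : Root m} {v : Var m}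
    (hα : IsPivotVar w α v) : x v = ∑ u with IsFreeVar w α u, x u := by
  obtain ⟨y, hy, rfl⟩ := hx
  have hbal : ∑ t, (y t (w t α.1) - y t (w t α.2)) = 0 := by
    rw [Finset.sum_sub_distrib, hy α.1, hy α.2, sub_zero]
  have hgroup : ∀ t, ∑ k : Fin m with w t α.1 ≤ k.castSucc ∧ k.succ ≤ w t α.2,
      (y t k.castSucc - y t k.succ) =
        (y t (w t α.1) - y t (w t α.2)) + if t = v.1 then gaps m y v else 0 := by
    intro t
    rw [sum_gaps_between]
    by_cases ht : t = v.1
    · subst ht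
      rw [if_neg (not_le.2 hα.inverts), if_pos rfl, hα.2.1, hα.2.2]
      simp [gaps]
    · have hle : w t α.1 ≤ w t α.2 := by
        by_contra! h
        exact ht (hw.invertsOnce.unique _ _ t v.1 hα.1 h hα.inverts)
      rw [if_pos hle, if_neg ht, add_zero]
  rw [Finset.sum_filter, Fintype.sum_prod_type]
  simp only [← Finset.sum_filter, IsFreeVar]
  change _ = ∑ t, ∑ k : Fin m with w t α.1 ≤ k.castSucc ∧ k.succ ≤ w t α.2,
      (y t k.castSucc - y t k.succ)
  rw [Finset.sum_congr rfl fun t _ => hgroup t, Finset.sum_add_distrib, hbal]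
  simp

theorem exists_gaps_eq (g : Fin m → ℝ) :
    ∃ y : Fin (m + 1) → ℝ, ∀ k : Fin m, y k.castSucc - y k.succ = g k := by
  refine ⟨fun i => -Fin.partialSum g i, fun k => ?_⟩
  simp only [Fin.partialSum_succ]
  ring

/-- The first two groups of gaps can be prescribed freely; balance then determines the third vector.
-/
theorem le_finrank_balancedSubspace (w : Fin 3 → Equiv.Perm (Fin (m + 1))) :
    2 * m ≤ Module.finrank ℝ (balancedSubspace w) := by
  let φ : balancedSubspace w →ₗ[ℝ] (Fin 2 × Fin m → ℝ) :=
    (LinearMap.funLeft ℝ ℝ fun p : Fin 2 × Fin m => (p.1.castSucc, p.2)) ∘ₗ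
      (balancedSubspace w).subtype
  have hφ : Function.Surjective φ := by
    intro g
    obtain ⟨a, ha⟩ := exists_gaps_eq fun k => g (0, k)
    obtain ⟨b, hb⟩ := exists_gaps_eq fun k => g (1, k)
    let y : Fin 3 → Fin (m + 1) → ℝ :=
      ![a, b, fun i => -a (w 0 ((w 2).symm i)) - b (w 1 ((w 2).symm i))]
    have hy : y ∈ balancedTriples w := fun i => by
      simp [y, Fin.sum_univ_three]
    refine ⟨⟨gaps m y, y, hy, rfl⟩, ?_⟩
    ext ⟨s, k⟩
    fin_cases s
    · exact ha k
    · exact hb k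
  have h := LinearMap.finrank_le_finrank_of_surjective hφ
  simpa using h

/-! ### Solving the equations -/

/-- The solutions of the equations obtained by back-substitution. -/
def solvedSubspace (w : Fin 3 → Equiv.Perm (Fin (m + 1))) (l : List (Root m)) :
    Submodule ℝ (Var m → ℝ) where
  carrier := {x | ∀ v, x v = ∑ f ∈ freeVars w, (backSubst w l v f : ℝ) * x f}
  add_mem' := by
    intro x y hx hy v
    simp only [Pi.add_apply, mul_add, Finset.sum_add_distrib]
    rw [← hx v, ← hy v]
  zero_mem' := by
    intro v
    simp
  smul_mem' := by
    intro c x hx v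
    simp only [Pi.smul_apply, smul_eq_mul, mul_left_comm _ c, ← Finset.mul_sum]
    rw [← hx v]

theorem finrank_solvedSubspace_le (w : Fin 3 → Equiv.Perm (Fin (m + 1))) (l : List (Root m)) :
    Module.finrank ℝ (solvedSubspace w l) ≤ (freeVars w).card := by
  let φ : solvedSubspace w l →ₗ[ℝ] (freeVars w → ℝ) :=
    (LinearMap.funLeft ℝ ℝ Subtype.val) ∘ₗ (solvedSubspace w l).subtype
  have hφ : Function.Injective φ := by
    intro x y hxy
    ext v
    rw [x.2 v, y.2 v]
    exact Finset.sum_congr rfl fun f hf => by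
      rw [show x.1 f = y.1 f from congrFun hxy ⟨f, hf⟩]
  simpa using LinearMap.finrank_le_finrank_of_injective hφ

theorem IsInversionDecomposition.balancedSubspace_le (hw : IsInversionDecomposition w)
    {l : List (Root m)} (hl : IsTriangularOrder w l) :
    balancedSubspace w ≤ solvedSubspace w l := fun x hx v => by
  rw [hl.sum_backSubst v (fun c f => (c : ℝ) * x f) (by simp)]
  exact eq_sum_backSubst (fun α v hα => hw.pivot_equation hx hα) l v

theorem IsInversionDecomposition.card_freeVars (hw : IsInversionDecomposition w) :
    (freeVars w).card = 2 * m := by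
  obtain ⟨l, hl⟩ := hw.exists_isTriangularOrder
  have h1 := le_finrank_balancedSubspace w
  have h2 := Submodule.finrank_mono (hw.balancedSubspace_le hl)
  have h3 := finrank_solvedSubspace_le w l
  have h4 := hw.card_freeVars_le
  omega

theorem IsInversionDecomposition.balancedSubspace_eq (hw : IsInversionDecomposition w)
    {l : List (Root m)} (hl : IsTriangularOrder w l) :
    balancedSubspace w = solvedSubspace w l := by
  refine Submodule.eq_of_le_of_finrank_le (hw.balancedSubspace_le hl) ?_
  have h1 := le_finrank_balancedSubspace w
  have h3 := finrank_solvedSubspace_le w l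
  have h4 := hw.card_freeVars_le
  omega

/-! ### The face -/

theorem ray_apply_of_mem_freeVars (l : List (Root m)) (f : Var m) {u : Var m}
    (hu : u ∈ freeVars w) : ray w l f u = if f = u then 1 else 0 := by
  rw [ray, backSubst_of_mem_freeVars l hu, Pi.single_apply]
  split_ifs <;> simp

theorem linearIndependent_ray (w : Fin 3 → Equiv.Perm (Fin (m + 1))) (l : List (Root m)) :
    LinearIndependent ℝ (fun f : freeVars w => ray w l f) := by
  rw [Fintype.linearIndependent_iff]
  intro g hg f
  have h := congrFun hg f
  simp only [Finset.sum_apply, Pi.smul_apply, smul_eq_mul,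
    ray_apply_of_mem_freeVars l _ f.2, Pi.zero_apply, Subtype.coe_inj, mul_ite, mul_one,
    mul_zero, Finset.sum_ite_eq', Finset.mem_univ, if_true] at h
  exact h

theorem ray_mem_solvedSubspace (l : List (Root m)) {f : Var m} (hf : f ∈ freeVars w) :
    ray w l f ∈ solvedSubspace w l := fun v => by
  rw [Finset.sum_congr rfl fun u hu => by rw [ray_apply_of_mem_freeVars l f hu]]
  simp [hf, ray]

/-- The coefficient of a solution along the ray of `f` is its coordinate at `f`, so dominance makes
the coefficients non-negative; conversely the rays have non-negative entries. -/
theorem hull_ray (w : Fin 3 → Equiv.Perm (Fin (m + 1))) (l : List (Root m)) :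
    (PointedCone.hull ℝ (Set.range fun f : freeVars w => ray w l f) : Set (Var m → ℝ)) =
      (solvedSubspace w l : Set (Var m → ℝ)) ∩ dominantCone m := by
  ext x
  rw [SetLike.mem_coe, PointedCone.hull, Submodule.mem_span_range_iff_exists_fun]
  constructor
  · rintro ⟨c, rfl⟩
    constructor
    · exact Submodule.sum_mem _ fun f _ =>
        Submodule.smul_mem _ (c f : ℝ) (ray_mem_solvedSubspace l f.2)
    · intro v
      rw [Finset.sum_apply]
      exact Finset.sum_nonneg fun f _ => mul_nonneg (c f).2 (Nat.cast_nonneg _)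
  · rintro ⟨hx, hdom⟩
    refine ⟨fun f => ⟨x f, hdom f⟩, ?_⟩
    funext v
    rw [hx v, Finset.sum_apply,
      ← Finset.sum_coe_sort (freeVars w) fun f => (backSubst w l v f : ℝ) * x f]
    exact Finset.sum_congr rfl fun f _ => mul_comm (x f) (backSubst w l v f : ℝ)

theorem gaps_nonneg_iff {y : Fin 3 → Fin (m + 1) → ℝ} :
    gaps m y ∈ dominantCone m ↔ ∀ s, Antitone (y s) := by
  constructor
  · intro h s
    exact Fin.antitone_iff_succ_le.2 fun k => sub_nonneg.1 (h (s, k))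
  · intro h v
    exact sub_nonneg.2 (h v.1 Fin.castSucc_lt_succ.le)

theorem lrFace_eq (w : Fin 3 → Equiv.Perm (Fin (m + 1))) :
    lrFace w = (balancedSubspace w : Set (Var m → ℝ)) ∩ dominantCone m := by
  ext x
  constructor
  · rintro ⟨hx, y, ⟨A, -, hA⟩, rfl⟩
    exact ⟨hx, gaps_nonneg_iff.2 fun s => (hA s).2.1⟩
  · rintro ⟨⟨y, hy, rfl⟩, hdom⟩
    have hanti := gaps_nonneg_iff.1 hdom
    refine ⟨⟨y, hy, rfl⟩, y,
      -- The `i`-th diagonal entries add up to the `i`-th balance equation, and permuting the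
      -- entries leaves the spectrum unchanged.
      ⟨fun s => Matrix.diagonal fun i => ((y s (w s i) : ℝ) : ℂ), ?_, fun s => ⟨?_, hanti s, ?_⟩⟩,
      rfl⟩
    · ext i j
      rw [Matrix.sum_apply]
      by_cases hij : i = j
      · subst hij
        simp only [Matrix.diagonal_apply_eq, Matrix.zero_apply, ← Complex.ofReal_sum, hy i,
          Complex.ofReal_zero]
      · simp [Matrix.diagonal_apply_ne _ hij]
    · exact Matrix.isHermitian_diagonal_of_self_adjoint _ (by ext i; simp)
    · rw [Matrix.charpoly_diagonal]
      exact Equiv.prod_comp (w s) fun i => Polynomial.X - Polynomial.C ((y s i : ℝ) : ℂ)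

theorem pos_subset_interior_dominantCone :
    {x : Var m → ℝ | ∀ v, 0 < x v} ⊆ interior (dominantCone m) := by
  refine interior_maximal (fun x hx v => (hx v).le) ?_
  simp only [Set.ofPred_forall]
  exact isOpen_iInter_of_finite fun v => isOpen_lt continuous_const (continuous_apply v)

theorem IsInversionDecomposition.hull_ray_eq_lrFace (hw : IsInversionDecomposition w)
    {l : List (Root m)} (hl : IsTriangularOrder w l) :
    (PointedCone.hull ℝ (Set.range fun f : freeVars w => ray w l f) : Set (Var m → ℝ)) =
      lrFace w := by
  rw [hull_ray, lrFace_eq, hw.balancedSubspace_eq hl]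

theorem IsInversionDecomposition.lrFace_inter_interior (hw : IsInversionDecomposition w) :
    (lrFace w ∩ interior (dominantCone m)).Nonempty := by
  obtain ⟨l, hl⟩ := hw.exists_isTriangularOrder
  have hpos : ∀ v, 0 < (∑ f ∈ freeVars w, ray w l f) v := fun v => by
    simp only [Finset.sum_apply, ray]
    rw [← Nat.cast_sum, hl.sum_backSubst v (fun c _ => c) fun _ => rfl]
    exact_mod_cast backSubst_sum_pos hw l v
  refine ⟨∑ f ∈ freeVars w, ray w l f, ?_, pos_subset_interior_dominantCone hpos⟩
  rw [lrFace_eq, hw.balancedSubspace_eq hl]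
  exact ⟨Submodule.sum_mem _ fun f hf => ray_mem_solvedSubspace l hf, fun v => (hpos v).le⟩

theorem IsInversionDecomposition.finrank_span_lrFace (hw : IsInversionDecomposition w) :
    Module.finrank ℝ (Submodule.span ℝ (lrFace w)) = 2 * m := by
  obtain ⟨l, hl⟩ := hw.exists_isTriangularOrder
  have h : Submodule.span ℝ (lrFace w) =
      Submodule.span ℝ (Set.range fun f : freeVars w => ray w l f) := by
    rw [← hw.hull_ray_eq_lrFace hl]
    exact le_antisymm (Submodule.span_le.2 (PointedCone.hull_le_span ℝ _))
      (Submodule.span_mono PointedCone.subset_hull)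
  rw [h, finrank_span_eq_card (linearIndependent_ray w l), Fintype.card_coe, hw.card_freeVars]

end LRCone

theorem mainTheorem8 (m : ℕ) (w : Fin 3 → Equiv.Perm (Fin (m + 1)))
    (hw : LRCone.IsInversionDecomposition w) :
    -- the face consists of all dominant points of `T`, meets the interior of the dominant cone,
    -- and has codimension `m = n - 1` in the space `(ℝ^m)³`
    LRCone.lrFace w = (LRCone.balancedSubspace w : Set (LRCone.Var m → ℝ)) ∩
        LRCone.dominantCone m ∧
    (LRCone.lrFace w ∩ interior (LRCone.dominantCone m)).Nonempty ∧
    Module.finrank ℝ (Submodule.span ℝ (LRCone.lrFace w)) = 2 * m ∧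
    -- it is a simplicial cone
    (∃ K : PointedCone ℝ (LRCone.Var m → ℝ),
        (K : Set (LRCone.Var m → ℝ)) = LRCone.lrFace w ∧ K.IsSimplicial) ∧
    -- the pivot roots can be ordered triangularly, and for every such order back-substitution
    -- solves the equations of `T` for the pivot variables and yields the generating rays
    (LRCone.freeVars w).card = 2 * m ∧
    (∃ l : List (LRCone.Root m), LRCone.IsTriangularOrder w l) ∧
    ∀ l : List (LRCone.Root m), LRCone.IsTriangularOrder w l →
      (∀ v u, LRCone.backSubst w l v u ≠ 0 → u ∈ LRCone.freeVars w) ∧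
      (∀ x : LRCone.Var m → ℝ, x ∈ LRCone.balancedSubspace w ↔
        ∀ v, x v = ∑ f ∈ LRCone.freeVars w, (LRCone.backSubst w l v f : ℝ) * x f) ∧
      LinearIndependent ℝ (fun f : LRCone.freeVars w => LRCone.ray w l f) ∧
      (PointedCone.hull ℝ (Set.range fun f : LRCone.freeVars w => LRCone.ray w l f) :
        Set (LRCone.Var m → ℝ)) = LRCone.lrFace w := by
  obtain ⟨l₀, hl₀⟩ := hw.exists_isTriangularOrder
  refine ⟨LRCone.lrFace_eq w, hw.lrFace_inter_interior, hw.finrank_span_lrFace,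
    ⟨_, hw.hull_ray_eq_lrFace hl₀, PointedCone.IsSimplicial.hull (Set.finite_range _)
      (LRCone.linearIndependent_ray w l₀).linearIndepOn_id⟩,
    hw.card_freeVars, ⟨l₀, hl₀⟩, fun l hl => ⟨fun v u h => hl.mem_freeVars h, fun x => ?_,
      LRCone.linearIndependent_ray w l, hw.hull_ray_eq_lrFace hl⟩⟩
  rw [hw.balancedSubspace_eq hl]
  rfl
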